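/- Let $\sigma$ be a relational signature (finite or infinite, every symbol of positive finite arity) with a distinguished binary symbol $E$, and put $\overline\sigma=\sigma\setminus\{E\}$. The formulas of the graded logic $\mathrm{PPML}^{\#}$ over $\sigma$ are $$\varphi ::= \top \mid R \mid \neg\varphi \mid \varphi\wedge\varphi \mid \Diamond_n\varphi\qquad (R\in\overline\sigma,\ n\ge 1).$$ They are evaluated in a $\sigma$-structure $\mathcal A$ at a nonempty finite sequence $s$ of elements of $|\mathcal A|$: $\top$ always holds and $\neg,\wedge$ have their usual meaning; $\mathcal A,s\models R$ iff $r=\mathrm{arity}(R)\le |s|$ and the tuple of the last $r$ entries of $s$ (in order) belongs to $R^{\mathcal A}$; and $\mathcal A,s\models\Diamond_n\varphi$ iff there are at least $n$ elements $a'\in|\mathcal A|$ such that $(\epsilon(s),a')\in E^{\mathcal A}$ and $\mathcal A,s.a'\models\varphi$, where $\epsilon(s)$ is the last entry of $s$ and $s.a'$ is $s$ extended by $a'$. The modal depth of a formula is the maximal number of nested modalities in it. Write $(\mathcal A,a)\equiv_k^{\#}(\mathcal B,b)$ if, for every $\mathrm{PPML}^{\#}$ formula $\varphi$ of modal depth at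 most $k$, $\mathcal A,[a]\models\varphi$ iff $\mathcal B,[b]\models\varphi$. A pp-tree is a pointed $\sigma$-structure $(\mathcal T,u)$ such that (1) $(|\mathcal T|,E^{\mathcal T},u)$ is a rooted tree, i.e. $u$ has no $E$-predecessor and every other point is accessible from $u$ by a finite $E$-path and has exactly one $E$-predecessor; and (2) for every $R\in\overline\sigma$ of arity $r$ and every $(u_1,\dots,u_r)\in R^{\mathcal T}$, $(u_i,u_{i+1})\in E^{\mathcal T}$ for all $1\le i<r$. Its height is the maximal length (number of edges) of an $E$-path starting at $u$. A structure is finite if its universe is finite. A pointed homomorphism is a map preserving all relations of $\sigma$ and the basepoint. Theorem. Let $k\ge 0$ and let $(\mathcal A,a)$ and $(\mathcal B,b)$ be finite pointed $\sigma$-structures. Then $(\mathcal A,a)\equiv_k^{\#}(\mathcal B,b)$ if and only if, for every finite pp-tree $(\mathcal T,u)$ of height at most $k$, the number of pointed homomorphisms $(\mathcal T,u)\to(\mathcal A,a)$ equals the number of pointed homomorphisms $(\mathcal T,u)\to(\mathcal B,b)$. -/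

import Mathlib

universe uF uR u v

open FirstOrder

namespace PPML

/-- Formulas of graded Path Predicate Modal Logic over a relational signature `σ` with a
distinguished binary symbol `E`. The atoms are the symbols of `σ` other than `E`; `dia n φ` is
the graded modality "at least `n` successors satisfy `φ`", `n` a positive integer. -/
inductive Formula (σ : FirstOrder.Language.{uF, uR}) (E : σ.Relations 2) : Type uR
  | top : Formula σ E
  | atom {r : ℕ} (R : σ.Relations r)
      (hR : (⟨r, R⟩ : Σ n : ℕ, σ.Relations n) ≠ ⟨2, E⟩) : Formula σ E
  | neg (φ : Formula σ E) : Formula σ E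
  | and (φ ψ : Formula σ E) : Formula σ E
  | dia (n : ℕ+) (φ : Formula σ E) : Formula σ E

/-- Modal depth: the maximal number of nested graded modalities. -/
def Formula.depth {σ : FirstOrder.Language.{uF, uR}} {E : σ.Relations 2} : Formula σ E → ℕ
  | .top => 0
  | .atom _ _ => 0
  | .neg φ => φ.depth
  | .and φ ψ => max φ.depth ψ.depth
  | .dia _ φ => φ.depth + 1

/-- The sequence of the last `r` entries of a sequence of length `m ≥ r`, in the same order. -/
def lastEntries {A : Type u} {m : ℕ} (s : Fin m → A) (r : ℕ) (h : r ≤ m) : Fin r → A :=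
  fun i => s ⟨m - r + i, by have := i.isLt; omega⟩

/-- The accessibility relation of a structure. -/
def accRel {σ : FirstOrder.Language.{uF, uR}} (E : σ.Relations 2) (A : Type u) [σ.Structure A]
    (x y : A) : Prop :=
  FirstOrder.Language.Structure.RelMap E ![x, y]

/-- Satisfaction of a formula in a structure `A` at a nonempty sequence `s`. -/
def Sat {σ : FirstOrder.Language.{uF, uR}} {E : σ.Relations 2} (A : Type u) [σ.Structure A] :
    Formula σ E → {ℓ : ℕ} → (Fin (ℓ + 1) → A) → Prop
  | .top, _, _ => True
  | .atom (r := r) R _, ℓ, s =>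
      ∃ h : r ≤ ℓ + 1, FirstOrder.Language.Structure.RelMap R (lastEntries s r h)
  | .neg φ, _, s => ¬ Sat A φ s
  | .and φ ψ, _, s => Sat A φ s ∧ Sat A ψ s
  | .dia n φ, ℓ, s =>
      ((n : ℕ) : ℕ∞) ≤ Set.encard {a : A |
        accRel E A (s (Fin.last ℓ)) a ∧
          Sat A φ (Fin.snoc (α := fun _ => A) s a)}

/-- `(A, a)` and `(B, b)` satisfy the same graded formulas of modal depth at most `k`. -/
def GradedEquiv {σ : FirstOrder.Language.{uF, uR}} (E : σ.Relations 2) (k : ℕ)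
    (A : Type u) [σ.Structure A] (a : A) (B : Type v) [σ.Structure B] (b : B) : Prop :=
  ∀ φ : Formula σ E, φ.depth ≤ k → (Sat A φ ![a] ↔ Sat B φ ![b])

/-- The `n`-fold composition of a binary relation with itself; the `0`-fold one is equality. -/
def RelPow {V : Type u} (R : V → V → Prop) : ℕ → V → V → Prop
  | 0 => Eq
  | n + 1 => Relation.Comp (RelPow R n) R

/-- `(V, R, root)` is a rooted tree: the root has no predecessor, and every other point is
accessible from the root and has a unique predecessor. -/
structure IsRootedTree {V : Type u} (R : V → V → Prop) (root : V) : Prop where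
  no_pred : ∀ w, ¬ R w root
  accessible : ∀ w, w ≠ root → Relation.TransGen R root w
  unique_pred : ∀ w, w ≠ root → ∃! p, R p w

/-- Every point of the rooted tree has height at most `k`; the height of a point `w` is the
(unique) `n` with `RelPow R n root w`. -/
def HeightLE {V : Type u} (R : V → V → Prop) (root : V) (k : ℕ) : Prop :=
  ∀ (w : V) (n : ℕ), RelPow R n root w → n ≤ k

/-- Path-predicate trees: pointed structures which are rooted trees with respect to `E`, and in
which every tuple in the interpretation of a symbol other than `E` is an `E`-chain. -/
structure IsPPTree {σ : FirstOrder.Language.{uF, uR}} (E : σ.Relations 2) (T : Type u) [σ.Structure T]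
    (root : T) : Prop where
  tree : IsRootedTree (accRel E T) root
  chain : ∀ {r : ℕ} (R : σ.Relations r), (⟨r, R⟩ : Σ n : ℕ, σ.Relations n) ≠ ⟨2, E⟩ →
    ∀ x : Fin r → T, FirstOrder.Language.Structure.RelMap R x →
      ∀ (i : ℕ) (hi : i + 1 < r), accRel E T (x ⟨i, by omega⟩) (x ⟨i + 1, hi⟩)

/-- Pointed homomorphisms. -/
abbrev PointedHom (σ : FirstOrder.Language.{uF, uR}) (A : Type u) [σ.Structure A] (a : A)
    (B : Type v) [σ.Structure B] (b : B) : Type (max u v) :=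
  {f : A →[σ] B // f a = b}

end PPML

/-! Truth at a sequence depends on the whole path travelled, so in both directions points are
compared together with their histories.

From formulas to counts: if two histories agree to depth `j + 1`, Hall's theorem matches the
successors of the first injectively with successors of the second, agreeing to depth `j`
(`exists_successor_injection`). In a pp-tree every tuple lies on the path to its last entry, so a
homomorphism into `A` can be pushed to `B` along these matchings, from the root downwards, and
recovered because they are injective (`exists_hom_injection`). By symmetry the two finite sets of
homomorphisms have equal size.

From counts to formulas: gluing trees at their roots multiplies counts, so on the disjoint union of
the successors of two histories the counts form a monoid of functions. By interpolation its span
contains every function constant on the classes that the counts do not separate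
(`mem_adjoin_of_forall_eq`). Hanging a tree below a new root sums its counts over the successors, so
equal counts give equal sums of every such function (`sum_successors_eq`). By induction the truth
value of a subformula is such a function, and equally many successors satisfy it on both sides
(`satAt_iff_of_count_eq`). -/

namespace PPML

/-! ### Histories, characteristic formulas and matching of successors. -/

open FirstOrder.Language.Structure

variable {σ : FirstOrder.Language.{uF, uR}} {E : σ.Relations 2}

/-- Satisfaction at a history: `a` is the current point, `l` lists the earlier points, the most
recent one first. -/
def SatAt (A : Type u) [σ.Structure A] : Formula σ E → A → List A → Prop
  | .top, _, _ => True
  | .atom (r := r) R _, a, l => ∃ x : Fin r → A, (List.ofFn x).reverse <+: a :: l ∧ RelMap R x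
  | .neg φ, a, l => ¬ SatAt A φ a l
  | .and φ ψ, a, l => SatAt A φ a l ∧ SatAt A ψ a l
  | .dia n φ, a, l => ((n : ℕ) : ℕ∞) ≤ Set.encard {x : A | accRel E A a x ∧ SatAt A φ x (a :: l)}

theorem ofFn_lastEntries {A : Type u} {m : ℕ} (s : Fin m → A) (r : ℕ) (h : r ≤ m) :
    List.ofFn (lastEntries s r h) = (List.ofFn s).drop (m - r) := by
  apply List.ext_getElem
  · simp; omega
  · intro i h₁ h₂
    simp [lastEntries]

theorem exists_suffix_ofFn_iff {A : Type u} {m r : ℕ} (s : Fin m → A) (P : (Fin r → A) → Prop) :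
    (∃ x : Fin r → A, List.ofFn x <:+ List.ofFn s ∧ P x) ↔
      ∃ h : r ≤ m, P (lastEntries s r h) := by
  constructor
  · rintro ⟨x, hx, hP⟩
    have h : r ≤ m := by simpa using hx.length_le
    refine ⟨h, ?_⟩
    have : x = lastEntries s r h := by
      apply List.ofFn_injective
      rw [ofFn_lastEntries]
      simpa using List.suffix_iff_eq_drop.1 hx
    exact this ▸ hP
  · rintro ⟨h, hP⟩
    exact ⟨_, by rw [ofFn_lastEntries]; exact List.drop_suffix _ _, hP⟩

theorem reverse_ofFn_snoc {A : Type u} {m : ℕ} (s : Fin m → A) (x : A) :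
    (List.ofFn (Fin.snoc (α := fun _ => A) s x : Fin (m + 1) → A)).reverse =
      x :: (List.ofFn s).reverse := by
  rw [List.ofFn_succ']
  simp

/-- Reversal turns extension of a sequence at its end into `cons`, so that later arguments can
recurse along histories. -/
theorem sat_iff_satAt {A : Type u} [σ.Structure A] (φ : Formula σ E) :
    ∀ {ℓ : ℕ} (s : Fin (ℓ + 1) → A) (a : A) (l : List A), (List.ofFn s).reverse = a :: l →
      (Sat A φ s ↔ SatAt A φ a l) := by
  induction φ with
  | top => intros; simp [Sat, SatAt]
  | atom R hR =>
    intro ℓ s a l h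
    rw [Sat, SatAt, ← h]
    simp only [List.reverse_prefix]
    exact (exists_suffix_ofFn_iff s _).symm
  | neg φ ih => intro ℓ s a l h; rw [Sat, SatAt, ih s a l h]
  | and φ ψ ih₁ ih₂ => intro ℓ s a l h; rw [Sat, SatAt, ih₁ s a l h, ih₂ s a l h]
  | dia n φ ih =>
    intro ℓ s a l h
    have hlast : s (Fin.last ℓ) = a := by
      rw [List.ofFn_succ'] at h
      simp at h
      exact h.1
    rw [Sat, SatAt, hlast]
    have : ∀ x, Sat A φ (Fin.snoc (α := fun _ => A) s x) ↔ SatAt A φ x (a :: l) := fun x =>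
      ih _ _ _ (by rw [reverse_ofFn_snoc, h])
    simp only [this]

theorem sat_singleton_iff {A : Type u} [σ.Structure A] (φ : Formula σ E) (a : A) :
    Sat A φ ![a] ↔ SatAt A φ a [] :=
  sat_iff_satAt φ _ _ _ (by simp)

/-- Two histories satisfy the same formulas of modal depth at most `j`. -/
def EquivAt (E : σ.Relations 2) {A : Type u} [σ.Structure A] {B : Type v} [σ.Structure B] (j : ℕ)
    (a : A) (l : List A) (b : B) (m : List B) : Prop :=
  ∀ φ : Formula σ E, φ.depth ≤ j → (SatAt A φ a l ↔ SatAt B φ b m)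

theorem gradedEquiv_iff_equivAt {A : Type u} [σ.Structure A] {B : Type v} [σ.Structure B] {k : ℕ}
    {a : A} {b : B} : GradedEquiv E k A a B b ↔ EquivAt E k a [] b [] := by
  simp only [GradedEquiv, EquivAt, sat_singleton_iff]

theorem exists_formula_of_not_equivAt {A : Type u} [σ.Structure A] {B : Type v} [σ.Structure B]
    {j : ℕ} {a : A} {l : List A} {b : B} {m : List B} (h : ¬ EquivAt E j a l b m) :
    ∃ φ : Formula σ E, φ.depth ≤ j ∧ SatAt A φ a l ∧ ¬ SatAt B φ b m := by
  simp only [EquivAt, not_forall] at h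
  obtain ⟨φ, hφ, hne⟩ := h
  by_cases hA : SatAt A φ a l
  · exact ⟨φ, hφ, hA, fun hB => hne (iff_of_true hA hB)⟩
  · refine ⟨.neg φ, hφ, hA, fun hB => hne (iff_of_false hA hB)⟩

/-- The formula is chosen before the structure, so that one formula can be evaluated in both `A` and
`B`. -/
theorem exists_conj {ι : Type*} (s : Finset ι) (j : ℕ) (φ : ι → Formula σ E)
    (hφ : ∀ i, (φ i).depth ≤ j) :
    ∃ ψ : Formula σ E, ψ.depth ≤ j ∧ ∀ (A : Type u) [σ.Structure A] (a : A) (l : List A),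
      SatAt A ψ a l ↔ ∀ i ∈ s, SatAt A (φ i) a l := by
  classical
  induction s using Finset.induction_on with
  | empty => exact ⟨.top, by simp [Formula.depth], by simp [SatAt]⟩
  | insert i s _ ih =>
    obtain ⟨ψ, hψ, h⟩ := ih
    exact ⟨.and (φ i) ψ, by simp [Formula.depth, hφ, hψ], fun A _ a l => by
      simp [SatAt, h]⟩

theorem exists_disj {ι : Type*} (s : Finset ι) (j : ℕ) (φ : ι → Formula σ E)
    (hφ : ∀ i, (φ i).depth ≤ j) :
    ∃ ψ : Formula σ E, ψ.depth ≤ j ∧ ∀ (A : Type u) [σ.Structure A] (a : A) (l : List A),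
      SatAt A ψ a l ↔ ∃ i ∈ s, SatAt A (φ i) a l := by
  obtain ⟨ψ, hψ, h⟩ := exists_conj.{uF, uR, u} s j (fun i => .neg (φ i)) hφ
  exact ⟨.neg ψ, hψ, fun A _ a l => by simp [SatAt, h]⟩

/-- A formula true at a given history `(a, l)` which, among the one-point extensions of a history in
the finite structure `B`, only holds at points equivalent to `(a, l)`. -/
theorem exists_characteristic_formula {A B : Type u} [σ.Structure A] [σ.Structure B] [Finite B]
    (j : ℕ) (a : A) (l : List A) (m : List B) :
    ∃ φ : Formula σ E, φ.depth ≤ j ∧ SatAt A φ a l ∧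
      ∀ y : B, SatAt B φ y m → EquivAt E j a l y m := by
  classical
  cases nonempty_fintype B
  -- Finiteness of `B` makes up for a possibly infinite signature: one separating formula per point
  -- is enough.
  have key : ∀ y : B, ∃ φ : Formula σ E, φ.depth ≤ j ∧ SatAt A φ a l ∧
      (SatAt B φ y m → EquivAt E j a l y m) := by
    intro y
    by_cases h : EquivAt E j a l y m
    · exact ⟨.top, by simp [Formula.depth], by simp [SatAt], fun _ => h⟩
    · obtain ⟨φ, h₁, h₂, h₃⟩ := exists_formula_of_not_equivAt h
      exact ⟨φ, h₁, h₂, fun h => absurd h h₃⟩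
  choose φ h₁ h₂ h₃ using key
  obtain ⟨ψ, hψ, h⟩ := exists_conj.{uF, uR, u} Finset.univ j φ h₁
  exact ⟨ψ, hψ, (h A a l).2 fun i _ => h₂ i,
    fun y hy => h₃ y ((h B y m).1 hy y (Finset.mem_univ y))⟩

/-- Equivalent histories have successors which can be matched injectively. -/
theorem exists_successor_injection {A B : Type u} [σ.Structure A] [σ.Structure B] [Finite A]
    [Finite B] {j : ℕ} {a : A} {l : List A} {b : B} {m : List B}
    (hab : EquivAt E (j + 1) a l b m) :
    ∃ β : A → B, (∀ x, accRel E A a x →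
        accRel E B b (β x) ∧ EquivAt E j x (a :: l) (β x) (b :: m)) ∧
      ∀ x x', accRel E A a x → accRel E A a x' → β x = β x' → x = x' := by
  classical
  cases nonempty_fintype A
  cases nonempty_fintype B
  let S := {x : A // accRel E A a x}
  let r : S → B → Prop := fun x y => accRel E B b y ∧ EquivAt E j x.1 (a :: l) y (b :: m)
  -- Hall's condition: the disjunction `ψ` of the characteristic formulas of the points of `X` holds
  -- at no fewer than `X.card` successors of `a`, hence at as many of `b`, each related to a point
  -- of `X`. Grades are positive, so empty `X` is treated apart.
  obtain ⟨f, hf, hr⟩ := (Fintype.all_card_le_filter_rel_iff_exists_injective r).1 <| by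
    intro X
    rcases X.eq_empty_or_nonempty with rfl | hX
    · simp
    choose φ h₁ h₂ h₃ using fun x : S =>
      exists_characteristic_formula (E := E) j x.1 (a :: l) (b :: m)
    obtain ⟨ψ, hψ, h⟩ := exists_disj.{uF, uR, u} X j φ h₁
    let n : ℕ+ := ⟨X.card, hX.card_pos⟩
    have hA : SatAt A (.dia n ψ) a l := by
      rw [SatAt]
      calc ((n : ℕ) : ℕ∞) = Set.encard (Subtype.val '' (X : Set S)) := by
            rw [Subtype.val_injective.injOn.encard_image, Set.encard_coe_eq_coe_finsetCard]; rfl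
        _ ≤ _ := Set.encard_le_encard <| by
            rintro _ ⟨x, hx, rfl⟩
            exact ⟨x.2, (h A _ _).2 ⟨x, hx, h₂ x⟩⟩
    have hB := (hab (.dia n ψ) (by simpa [Formula.depth] using hψ)).1 hA
    rw [SatAt] at hB
    have : ((n : ℕ) : ℕ∞) ≤ Set.encard
        ((Finset.univ.filter fun y => ∃ x ∈ X, r x y : Finset B) : Set B) := by
      refine hB.trans (Set.encard_le_encard ?_)
      rintro y ⟨hy, hs⟩
      obtain ⟨x, hx, hxy⟩ := (h B _ _).1 hs
      simp only [Finset.coe_filter, Finset.mem_univ, true_and, Set.mem_ofPred_eq]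
      exact ⟨x, hx, hy, h₃ x y hxy⟩
    rw [Set.encard_coe_eq_coe_finsetCard] at this
    exact_mod_cast this
  refine ⟨fun x => if h : accRel E A a x then f ⟨x, h⟩ else b, fun x hx => ?_,
    fun x x' hx hx' h => ?_⟩
  · simpa [hx] using hr ⟨x, hx⟩
  · simp only [hx, hx', dif_pos] at h
    exact congrArg Subtype.val (hf h)

end PPML

/-! ### Transporting homomorphisms from a pp-tree. -/

namespace PPML

open FirstOrder.Language.Structure

variable {σ : FirstOrder.Language.{uF, uR}} {E : σ.Relations 2}

/-- `IsPathTo R root v l`: the points of the path from `root` to `v` before `v` are listed by `l`,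
in reverse order. -/
inductive IsPathTo {V : Type u} (R : V → V → Prop) (root : V) : V → List V → Prop
  | nil : IsPathTo R root root []
  | cons {p v : V} {l : List V} : R p v → IsPathTo R root p l → IsPathTo R root v (p :: l)

namespace IsRootedTree

variable {V : Type u} {R : V → V → Prop} {root : V}

theorem exists_path (hT : IsRootedTree R root) (v : V) : ∃ l, IsPathTo R root v l := by
  by_cases hv : v = root
  · subst hv; exact ⟨[], IsPathTo.nil⟩
  · induction hT.accessible v hv with
    | single h => exact ⟨_, IsPathTo.cons h IsPathTo.nil⟩
    | @tail p w _ h ih =>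
      by_cases hp : p = root
      · subst hp; exact ⟨_, IsPathTo.cons h IsPathTo.nil⟩
      · obtain ⟨l, hl⟩ := ih hp
        exact ⟨_, IsPathTo.cons h hl⟩

theorem pred_unique (hT : IsRootedTree R root) {p q v : V} (hp : R p v) (hq : R q v) : p = q :=
  (hT.unique_pred v (by rintro rfl; exact hT.no_pred p hp)).unique hp hq

theorem path_unique (hT : IsRootedTree R root) {v : V} {l l' : List V} (h : IsPathTo R root v l)
    (h' : IsPathTo R root v l') : l = l' := by
  induction h generalizing l' with
  | nil =>
    cases h' with
    | nil => rfl
    | cons h _ => exact absurd h (hT.no_pred _)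
  | cons h _ ih =>
    cases h' with
    | nil => exact absurd h (hT.no_pred _)
    | cons h₂ hp =>
      obtain rfl := hT.pred_unique h h₂
      rw [ih hp]

/-- Predecessors are unique, so climbing from `v` can only retrace the path from the root, and must
stop there at the latest. -/
theorem chain_prefix_path (hT : IsRootedTree R root) {v : V} {L l : List V}
    (hL : (v :: L).IsChain (fun x y => R y x)) (hl : IsPathTo R root v l) : v :: L <+: v :: l := by
  induction L generalizing v l with
  | nil => simp
  | cons p L ih =>
    rw [List.isChain_cons_cons] at hL
    cases hl with
    | nil => exact absurd hL.1 (hT.no_pred _)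
    | cons h hp =>
      obtain rfl := hT.pred_unique h hL.1
      exact (List.prefix_cons_inj _).2 (ih hL.2 hp)

end IsRootedTree

theorem IsPathTo.relPow {V : Type u} {R : V → V → Prop} {root v : V} {l : List V}
    (h : IsPathTo R root v l) : RelPow R l.length root v := by
  induction h with
  | nil => exact rfl
  | cons h _ ih => exact ⟨_, ih, h⟩

theorem isChain_ofFn {V : Type*} {R : V → V → Prop} {r : ℕ} {x : Fin r → V}
    (h : ∀ (i : ℕ) (hi : i + 1 < r), R (x ⟨i, by omega⟩) (x ⟨i + 1, hi⟩)) :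
    (List.ofFn x).reverse.IsChain (fun x y => R y x) := by
  rw [List.isChain_reverse, List.isChain_iff_getElem]
  intro i hi
  simpa using h i (by simpa using hi)

/-- In a pp-tree, every tuple of a relation lies at the end of the path to its last entry. -/
theorem IsPPTree.reverse_prefix_path {T : Type u} [σ.Structure T] {t : T} (hT : IsPPTree E T t)
    {r : ℕ} (R : σ.Relations (r + 1)) (hR : (⟨r + 1, R⟩ : Σ n : ℕ, σ.Relations n) ≠ ⟨2, E⟩)
    {x : Fin (r + 1) → T} (hx : RelMap R x) {l : List T}
    (hl : IsPathTo (accRel E T) t (x (Fin.last r)) l) :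
    (List.ofFn x).reverse <+: x (Fin.last r) :: l := by
  have h := isChain_ofFn (hT.chain R hR x hx)
  rw [List.ofFn_succ'] at h ⊢
  simp only [List.concat_eq_append, List.reverse_append, List.reverse_cons, List.reverse_nil,
    List.nil_append, List.singleton_append] at h ⊢
  exact hT.tree.chain_prefix_path h hl

section transfer

variable {A B : Type u}

/-- Transport of a path, given as current point and reversed list of earlier points, along a family
of maps. -/
def transfer (b : B) (β : A → List A → B → List B → A → B) : A → List A → B × List B
  | _, [] => (b, [])
  | x, x' :: l =>
    (β x' l (transfer b β x' l).1 (transfer b β x' l).2 x,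
      (transfer b β x' l).1 :: (transfer b β x' l).2)

end transfer

/-- The image of a point is chosen by the matching at its predecessor's pair of histories. The depth
of agreement left at a point is `k` minus its distance from the root, so the height bound leaves at
least one level wherever there is a child. -/
theorem exists_hom_injection {A B : Type u} [Finite A] [Finite B] [σ.Structure A] [σ.Structure B]
    [σ.IsRelational] [IsEmpty (σ.Relations 0)] {k : ℕ} {a : A} {b : B}
    (hab : EquivAt E k a [] b []) {T : Type u} [σ.Structure T] {t : T} (hT : IsPPTree E T t)
    (hk : HeightLE (accRel E T) t k) :
    ∃ F : PointedHom σ T t A a → PointedHom σ T t B b, Function.Injective F := by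
  classical
  -- The depth is written as a successor; it equals `k - l.length` once `l.length < k`. Without
  -- equivalence the constant map is a junk value.
  have step : ∀ (x : A) (l : List A) (y : B) (m : List B), ∃ β : A → B,
      EquivAt E (k - (l.length + 1) + 1) x l y m →
        (∀ x', accRel E A x x' → accRel E B y (β x') ∧
          EquivAt E (k - (l.length + 1)) x' (x :: l) (β x') (y :: m)) ∧
        ∀ x' x'', accRel E A x x' → accRel E A x x'' → β x' = β x'' → x' = x'' := by
    intro x l y m
    by_cases h : EquivAt E (k - (l.length + 1) + 1) x l y m
    · obtain ⟨β, hβ⟩ := exists_successor_injection h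
      exact ⟨β, fun _ => hβ⟩
    · exact ⟨fun _ => y, fun h' => absurd h' h⟩
  choose β hβ using step
  choose path hpath using hT.tree.exists_path
  have path_root : path t = [] := hT.tree.path_unique (hpath t) .nil
  have path_succ : ∀ {p v : T}, accRel E T p v → path v = p :: path p := fun h =>
    hT.tree.path_unique (hpath _) (.cons h (hpath _))
  have length_le : ∀ v, (path v).length ≤ k := fun v => hk _ _ (hpath v).relPow
  let g : (T → A) → T → B := fun f v => (transfer b β (f v) ((path v).map f)).1
  have g_root : ∀ f, g f t = b := fun f => by simp [g, path_root, transfer]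
  have induct : ∀ {P : T → Prop}, P t → (∀ p v, accRel E T p v → P p → P v) → ∀ v, P v := by
    intro P h₀ h₁ v
    have := hpath v
    generalize path v = l at this
    induction this with
    | nil => exact h₀
    | cons h _ ih => exact h₁ _ _ h ih
  have transfer_snd : ∀ f v, (transfer b β (f v) ((path v).map f)).2 = (path v).map (g f) := by
    intro f
    apply induct
    · simp [path_root, transfer]
    · intro p v h ih
      rw [path_succ h]
      simp [transfer, ih, g]
  have g_succ : ∀ f {p v}, accRel E T p v →
      g f v = β (f p) ((path p).map f) (g f p) ((path p).map (g f)) (f v) := by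
    intro f p v h
    simp only [g, path_succ h, List.map_cons, transfer]
    rw [transfer_snd f p]
  have mapE : ∀ f : T →[σ] A, ∀ {p v}, accRel E T p v → accRel E A (f p) (f v) := by
    intro f p v h
    have := f.map_rel' E _ h
    rwa [show f.toFun ∘ ![p, v] = ![f p, f v] by ext i; fin_cases i <;> rfl] at this
  have equiv : ∀ f : PointedHom σ T t A a, ∀ v, EquivAt E (k - (path v).length) (f.1 v)
      ((path v).map f.1) (g f.1 v) ((path v).map (g f.1)) := by
    intro f
    apply induct
    · simpa [path_root, f.2, g_root] using hab
    · intro p v h ih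
      have hlen := length_le v
      rw [path_succ h, List.length_cons] at hlen
      have hβ' := hβ (f.1 p) ((path p).map f.1) (g f.1 p) ((path p).map (g f.1))
        (by rwa [List.length_map, show k - ((path p).length + 1) + 1 = k - (path p).length by omega])
      rw [g_succ f.1 h, path_succ h]
      simpa using (hβ'.1 (f.1 v) (mapE f.1 h)).2
  have edge : ∀ f : PointedHom σ T t A a, ∀ {p v}, accRel E T p v →
      (∀ x' x'', accRel E A (f.1 p) x' → accRel E A (f.1 p) x'' →
        β (f.1 p) ((path p).map f.1) (g f.1 p) ((path p).map (g f.1)) x' =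
          β (f.1 p) ((path p).map f.1) (g f.1 p) ((path p).map (g f.1)) x'' → x' = x'') ∧
      accRel E B (g f.1 p) (g f.1 v) := by
    intro f p v h
    have hlen := length_le v
    rw [path_succ h, List.length_cons] at hlen
    have ih := equiv f p
    have hβ' := hβ (f.1 p) ((path p).map f.1) (g f.1 p) ((path p).map (g f.1))
      (by rwa [List.length_map, show k - ((path p).length + 1) + 1 = k - (path p).length by omega])
    rw [g_succ f.1 h]
    exact ⟨hβ'.2, (hβ'.1 (f.1 v) (mapE f.1 h)).1⟩
  have mapRel : ∀ f : PointedHom σ T t A a, ∀ {r : ℕ} (R : σ.Relations r) (x : Fin r → T),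
      RelMap R x → RelMap R (g f.1 ∘ x) := by
    intro f r R x hx
    -- `E` is not an atom: edges are preserved because matchings go to successors, other symbols
    -- because the histories satisfy the same atoms.
    by_cases hR : (⟨r, R⟩ : Σ n : ℕ, σ.Relations n) = ⟨2, E⟩
    · obtain rfl : r = 2 := congrArg Sigma.fst hR
      obtain rfl : R = E := by simpa using hR
      have hx' : x = ![x 0, x 1] := by ext i; fin_cases i <;> rfl
      rw [hx'] at hx
      have := (edge f hx).2
      rwa [accRel, show ![g f.1 (x 0), g f.1 (x 1)] = g f.1 ∘ x by
        ext i; fin_cases i <;> rfl] at this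
    · cases r with
      | zero => exact isEmptyElim R
      | succ r =>
        have hpre := hT.reverse_prefix_path R hR hx (hpath (x (Fin.last r)))
        have map_pre : ∀ {C : Type u} (f : T → C), (List.ofFn (f ∘ x)).reverse <+:
            f (x (Fin.last r)) :: (path (x (Fin.last r))).map f := by
          intro C f
          have := hpre.map f
          rwa [List.map_reverse, List.map_ofFn] at this
        -- The atom only provides some related tuple `y` ending the history in `B`; prefixes of
        -- equal length coincide, so `y` is `g f.1 ∘ x`.
        obtain ⟨y, hy, hRy⟩ := ((equiv f (x (Fin.last r))) (.atom R hR) (Nat.zero_le _)).1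
          ⟨f.1 ∘ x, map_pre f.1, f.1.map_rel' R x hx⟩
        have := List.prefix_of_prefix_length_le hy (map_pre (g f.1)) (by simp)
        have := List.reverse_injective (this.eq_of_length (by simp))
        rwa [List.ofFn_injective this] at hRy
  refine ⟨fun f => ⟨⟨g f.1, fun c => isEmptyElim c, fun R x hx => mapRel f R x hx⟩, g_root f.1⟩, ?_⟩
  intro f f' hff
  have hg : ∀ v, g f.1 v = g f'.1 v := fun v =>
    DFunLike.congr_fun (congrArg Subtype.val hff : _) v
  -- Once `f` and `f'` agree on the path to `p`, the same matching is applied to their values at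
  -- `v`, and it is injective on successors.
  have hmap : ∀ v, f.1 v = f'.1 v ∧ (path v).map f.1 = (path v).map f'.1 := by
    apply induct
    · simp [path_root, f.2, f'.2]
    · intro p v h ih
      have hl : (path v).map f.1 = (path v).map f'.1 := by
        simp [path_succ h, ih.1, ih.2]
      refine ⟨(edge f h).1 _ _ (mapE f.1 h) (by rw [ih.1]; exact mapE f'.1 h) ?_, hl⟩
      have hmg : (path p).map (g f.1) = (path p).map (g f'.1) := by simp [hg]
      have h₂ := g_succ f'.1 h
      rw [← hg v, ← ih.1, ← ih.2, ← hg p, ← hmg] at h₂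
      rw [← g_succ f.1 h, h₂]
  exact Subtype.ext (DFunLike.ext _ _ fun v => (hmap v).1)

instance finite_hom {A B : Type*} [σ.Structure A] [σ.Structure B] [Finite A] [Finite B] :
    Finite (A →[σ] B) :=
  Finite.of_injective _ DFunLike.coe_injective

theorem card_pointedHom_eq {A B : Type u} [Finite A] [Finite B] [σ.Structure A] [σ.Structure B]
    [σ.IsRelational] [IsEmpty (σ.Relations 0)] {k : ℕ} {a : A} {b : B}
    (hab : EquivAt E k a [] b []) {T : Type u} [Finite T] [σ.Structure T] {t : T}
    (hT : IsPPTree E T t) (hk : HeightLE (accRel E T) t k) :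
    Nat.card (PointedHom σ T t A a) = Nat.card (PointedHom σ T t B b) := by
  obtain ⟨F, hF⟩ := exists_hom_injection hab hT hk
  obtain ⟨G, hG⟩ := exists_hom_injection (fun φ hφ => (hab φ hφ).symm) hT hk
  exact le_antisymm (Nat.card_le_card_of_injective F hF) (Nat.card_le_card_of_injective G hG)

end PPML

/-! ### Finite pp-trees built inductively from coloured points. -/

namespace PPML

open FirstOrder.Language.Structure

variable {σ : FirstOrder.Language.{uF, uR}} {E : σ.Relations 2}

/-- Finite rooted trees whose points carry sets of relation symbols: `graft t t'` adds `t'` as a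
subtree directly below the root of `t`. -/
inductive ColTree {σ : FirstOrder.Language.{uF, uR}} (E : σ.Relations 2) : Type uR
  | leaf (c : Set (Σ n : ℕ, σ.Relations n)) : ColTree E
  | graft (t t' : ColTree E) : ColTree E

namespace ColTree

/-- An upper bound of the height. -/
def height : ColTree E → ℕ
  | leaf _ => 0
  | graft t t' => max t.height (t'.height + 1)

/-- The points of a tree. -/
def Point : ColTree E → Type u
  | leaf _ => PUnit
  | graft t t' => Point t ⊕ Point t'

/-- The points of `t` in `graft t t'`. -/
def base {t t' : ColTree E} : Point.{uF, uR, u} t → Point.{uF, uR, u} (graft t t') := Sum.inl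

/-- The points of `t'` in `graft t t'`. -/
def branch {t t' : ColTree E} : Point.{uF, uR, u} t' → Point.{uF, uR, u} (graft t t') := Sum.inr

theorem forall_graft {t t' : ColTree E} {P : Point.{uF, uR, u} (graft t t') → Prop} :
    (∀ v, P v) ↔ (∀ v, P (base v)) ∧ ∀ v, P (branch v) :=
  Sum.forall

/-- The root of a tree. -/
def root : (t : ColTree E) → Point.{uF, uR, u} t
  | leaf _ => PUnit.unit
  | graft t _ => base (root t)

/-- The colour of a point. -/
def color : (t : ColTree E) → Point.{uF, uR, u} t → Set (Σ n : ℕ, σ.Relations n)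
  | leaf c => fun _ => c
  | graft t t' => Sum.elim (color t) (color t')

/-- The path from the root to a point, both included, in reverse order. -/
def path : (t : ColTree E) → Point.{uF, uR, u} t → List (Point.{uF, uR, u} t)
  | leaf _ => fun v => [v]
  | graft t t' => Sum.elim (fun v => (path t v).map base)
      (fun v => (path t' v).map branch ++ [base (root t)])

theorem path_base {t t' : ColTree E} (v : Point.{uF, uR, u} t) :
    path (graft t t') (base v) = (path t v).map base := rfl

theorem path_branch {t t' : ColTree E} (v : Point.{uF, uR, u} t') :
    path (graft t t') (branch v) = (path t' v).map branch ++ [base (root t)] := rfl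

theorem color_base {t t' : ColTree E} (v : Point.{uF, uR, u} t) :
    color (graft t t') (base v) = color t v := rfl

theorem color_branch {t t' : ColTree E} (v : Point.{uF, uR, u} t') :
    color (graft t t') (branch v) = color t' v := rfl

theorem root_graft {t t' : ColTree E} :
    root.{uF, uR, u} (graft t t') = base (root t) := rfl

instance finite_point : (t : ColTree E) → Finite (Point.{uF, uR, u} t)
  | leaf _ => inferInstanceAs (Finite PUnit)
  | graft t t' =>
    have := finite_point t
    have := finite_point t'
    inferInstanceAs (Finite (Point t ⊕ Point t'))

theorem path_root (t : ColTree E) : path.{uF, uR, u} t (root t) = [root t] := by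
  induction t with
  | leaf c => rfl
  | graft t t' ih _ => rw [root_graft, path_base, ih, List.map_singleton]

theorem exists_path_eq_cons (t : ColTree E) :
    ∀ v : Point.{uF, uR, u} t, ∃ l, path t v = v :: l := by
  induction t with
  | leaf c => exact fun v => ⟨[], rfl⟩
  | graft t t' ih₁ ih₂ =>
    refine forall_graft.2 ⟨fun v => ?_, fun v => ?_⟩
    · obtain ⟨l, hl⟩ := ih₁ v
      exact ⟨l.map base, by rw [path_base, hl, List.map_cons]⟩
    · obtain ⟨l, hl⟩ := ih₂ v
      exact ⟨l.map branch ++ [base (root t)], by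
        rw [path_branch, hl, List.map_cons, List.cons_append]⟩

theorem root_suffix_path (t : ColTree E) :
    ∀ v : Point.{uF, uR, u} t, [root t] <:+ path t v := by
  induction t with
  | leaf c => exact fun v => List.suffix_rfl
  | graft t t' ih₁ _ =>
    refine forall_graft.2 ⟨fun v => ?_, fun v => ?_⟩
    · exact (ih₁ v).map base
    · exact List.suffix_append _ _

/-- Lets the path of every ancestor, and hence the edges, be read off the path to a descendant. -/
theorem path_of_suffix (t : ColTree E) : ∀ (v w : Point.{uF, uR, u} t) (l : List (Point t)),
    w :: l <:+ path t v → path t w = w :: l := by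
  induction t with
  | leaf c =>
    intro v w l h
    have hlen : l.length + 1 ≤ 1 := h.length_le
    obtain rfl : l = [] := List.eq_nil_of_length_eq_zero (by omega)
    rfl
  | graft t t' ih₁ ih₂ =>
    refine forall_graft.2 ⟨fun v w l h => ?_, fun v w l h => ?_⟩
    · rw [path_base] at h
      obtain ⟨l₀, hl₀, hm⟩ := List.suffix_map_iff.1 h
      cases l₀ with
      | nil => simp at hm
      | cons w₀ l₀ =>
        rw [List.map_cons, List.cons.injEq] at hm
        obtain ⟨rfl, rfl⟩ := hm
        rw [path_base, ih₁ v w₀ l₀ hl₀, List.map_cons]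
    · rw [path_branch] at h
      obtain h | ⟨s, hs, hm⟩ := List.suffix_concat_iff.1 h
      · simp at h
      · obtain ⟨l₀, hl₀, rfl⟩ := List.suffix_map_iff.1 hm
        cases l₀ with
        | nil =>
          rw [List.map_nil, List.nil_append, List.cons.injEq] at hs
          obtain ⟨rfl, rfl⟩ := hs
          exact path_root (graft t t')
        | cons w₀ l₀ =>
          rw [List.map_cons, List.cons_append, List.cons.injEq] at hs
          obtain ⟨rfl, rfl⟩ := hs
          rw [path_branch, ih₂ v w₀ l₀ hl₀, List.map_cons, List.cons_append]

theorem length_path_le (t : ColTree E) :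
    ∀ v : Point.{uF, uR, u} t, (path t v).length ≤ t.height + 1 := by
  induction t with
  | leaf c => exact fun v => le_rfl
  | graft t t' ih₁ ih₂ =>
    refine forall_graft.2 ⟨fun v => ?_, fun v => ?_⟩
    · have := ih₁ v
      rw [path_base, List.length_map, height]
      omega
    · have := ih₂ v
      rw [path_branch, List.length_append, List.length_map, height, List.length_singleton]
      omega

/-- The structure of a coloured tree: the symbols at a point hold at the ends of the path to it. -/
instance structurePoint [σ.IsRelational] (t : ColTree E) : σ.Structure (Point.{uF, uR, u} t) where
  funMap c := isEmptyElim c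
  -- `E` is imposed at every point and yields the edge from its predecessor; the path to the root is
  -- too short to contain a pair.
  RelMap {r} R x := ∃ v, (⟨r, R⟩ : Σ n : ℕ, σ.Relations n) ∈ insert ⟨2, E⟩ (color t v) ∧
    (List.ofFn x).reverse <+: path t v

theorem relMap_iff [σ.IsRelational] (t : ColTree E) {r : ℕ} (R : σ.Relations r)
    (x : Fin r → Point.{uF, uR, u} t) : RelMap R x ↔
      ∃ v, (⟨r, R⟩ : Σ n : ℕ, σ.Relations n) ∈ insert ⟨2, E⟩ (color t v) ∧
        (List.ofFn x).reverse <+: path t v := Iff.rfl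

theorem accRel_of_infix [σ.IsRelational] (t : ColTree E) {x y v : Point.{uF, uR, u} t}
    (h : [y, x] <:+: path t v) : accRel E (Point t) x y := by
  obtain ⟨l₁, l₂, h⟩ := h
  refine (relMap_iff t E _).2 ⟨y, Set.mem_insert _ _, ?_⟩
  have : path t y = y :: x :: l₂ := path_of_suffix t v y _ ⟨l₁, by simpa using h⟩
  rw [this]
  exact ⟨l₂, by simp⟩

theorem accRel_iff [σ.IsRelational] (t : ColTree E) (x y : Point.{uF, uR, u} t) :
    accRel E (Point t) x y ↔ path t y = y :: path t x := by
  constructor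
  · intro h
    obtain ⟨v, -, l, hl⟩ := (relMap_iff t E _).1 h
    have h₂ : path t v = y :: x :: l := by rw [← hl]; simp
    rw [path_of_suffix t v y (x :: l) (h₂ ▸ List.suffix_rfl),
      path_of_suffix t v x l (h₂ ▸ List.suffix_cons y (x :: l))]
  · intro h
    obtain ⟨l, hl⟩ := exists_path_eq_cons t x
    exact accRel_of_infix t (v := y) ⟨[], l, by rw [h, hl]; simp⟩

theorem path_injective (t : ColTree E) : Function.Injective (path.{uF, uR, u} t) := by
  intro x y h
  obtain ⟨l, hl⟩ := exists_path_eq_cons t x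
  obtain ⟨m, hm⟩ := exists_path_eq_cons t y
  rw [hl, hm] at h
  exact (List.cons.inj h).1

theorem exists_pred [σ.IsRelational] (t : ColTree E) (v : Point.{uF, uR, u} t) (hv : v ≠ root t) :
    ∃ p, accRel E (Point t) p v := by
  obtain ⟨l, hl⟩ := exists_path_eq_cons t v
  cases l with
  | nil =>
    have := root_suffix_path t v
    rw [hl, List.suffix_iff_eq_drop] at this
    simp only [List.length_cons, List.length_nil, Nat.sub_self, List.drop_zero,
      List.cons.injEq, and_true] at this
    exact absurd this.symm hv
  | cons p l => exact ⟨p, accRel_of_infix t (v := v) ⟨[], l, by rw [hl]; simp⟩⟩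

theorem isRootedTree [σ.IsRelational] (t : ColTree E) :
    IsRootedTree (accRel E (Point.{uF, uR, u} t)) (root t) where
  no_pred w h := by
    obtain ⟨l, hl⟩ := exists_path_eq_cons t w
    rw [accRel_iff, path_root, hl] at h
    simp at h
  accessible w hw := by
    induction hn : (path t w).length generalizing w with
    | zero => obtain ⟨l, hl⟩ := exists_path_eq_cons t w; simp [hl] at hn
    | succ n ih =>
      obtain ⟨p, hp⟩ := exists_pred t w hw
      by_cases h : p = root t
      · exact .single (h ▸ hp)
      · refine .tail (ih p h ?_) hp
        rw [(accRel_iff t p w).1 hp, List.length_cons] at hn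
        omega
  unique_pred w hw := by
    obtain ⟨p, hp⟩ := exists_pred t w hw
    refine ⟨p, hp, fun q hq => path_injective t ?_⟩
    rw [accRel_iff] at hp hq
    exact (List.cons.inj (hq.symm.trans hp)).2

theorem isPPTree [σ.IsRelational] (t : ColTree E) : IsPPTree E (Point.{uF, uR, u} t) (root t) where
  tree := isRootedTree t
  chain {r} R _ x hx i hi := by
    obtain ⟨v, -, hv⟩ := (relMap_iff t R x).1 hx
    refine accRel_of_infix t (v := v) (List.IsInfix.trans ?_ hv.isInfix)
    have : [x ⟨i + 1, hi⟩, x ⟨i, by omega⟩] = [x ⟨i, by omega⟩, x ⟨i + 1, hi⟩].reverse := rfl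
    rw [this, List.reverse_infix]
    refine ⟨(List.ofFn x).take i, (List.ofFn x).drop (i + 2), ?_⟩
    conv_rhs => rw [← List.take_append_drop i (List.ofFn x)]
    rw [List.append_assoc, List.drop_eq_getElem_cons (i := i) (by simp; omega),
      List.drop_eq_getElem_cons (i := i + 1) (by simpa using hi)]
    simp

theorem heightLE [σ.IsRelational] (t : ColTree E) {k : ℕ} (hk : t.height ≤ k) :
    HeightLE (accRel E (Point.{uF, uR, u} t)) (root t) k := by
  have key : ∀ (n : ℕ) (w : Point.{uF, uR, u} t), RelPow (accRel E (Point t)) n (root t) w →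
      (path t w).length = n + 1 := by
    intro n
    induction n with
    | zero =>
      intro w h
      obtain rfl : root t = w := h
      rw [path_root, List.length_singleton]
    | succ n ih =>
      rintro w ⟨p, hp, h⟩
      rw [(accRel_iff t p w).1 h, List.length_cons, ih p hp]
  intro w n h
  have := key n w h
  have := length_path_le t w
  omega

/-! ### Counting homomorphisms by recursion on the tree. -/

section count

variable {A : Type u} [σ.Structure A]

/-- The tuple of the latest entries of a history, if it is long enough, is related by `R`. -/
def HoldsAt (R : Σ n : ℕ, σ.Relations n) (l : List A) : Prop :=
  ∀ x : Fin R.1 → A, (List.ofFn x).reverse <+: l → RelMap R.2 x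

/-- A map which respects the colours when the path to the root is extended by `l`. -/
def RespectsColors (t : ColTree E) (l : List A) (f : Point.{uF, uR, u} t → A) : Prop :=
  ∀ v, ∀ R ∈ insert (⟨2, E⟩ : Σ n : ℕ, σ.Relations n) (color t v),
    HoldsAt R ((path t v).map f ++ l)

/-- A path into `t'` meets `t` only in its root, so for `t'` grafting just lengthens the history by
the image of that root. This is why a history `l` is carried along. -/
theorem respectsColors_graft {t t' : ColTree E} {l : List A}
    {f : Point.{uF, uR, u} (graft t t') → A} :
    RespectsColors (graft t t') l f ↔ RespectsColors t l (f ∘ base) ∧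
      RespectsColors t' (f (base (root t)) :: l) (f ∘ branch) := by
  simp only [RespectsColors, forall_graft, path_base, path_branch, color_base, color_branch,
    List.map_map, List.map_append, List.map_singleton, List.append_assoc, List.singleton_append]

theorem isHom_iff_respectsColors [σ.IsRelational] {t : ColTree E} {f : Point.{uF, uR, u} t → A} :
    (∀ {r : ℕ} (R : σ.Relations r) (x : Fin r → Point t), RelMap R x → RelMap R (f ∘ x)) ↔
      RespectsColors t [] f := by
  constructor
  · intro h v R hR y hy
    rw [List.append_nil] at hy
    obtain ⟨m, hm, hym⟩ := List.prefix_map_iff.1 hy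
    have hlen : m.length = R.1 := by simpa using (congrArg List.length hym).symm
    obtain ⟨x, hx⟩ : ∃ x : Fin R.1 → Point t, (List.ofFn x).reverse = m := by
      refine ⟨fun i => m.reverse[i]'(by simp [hlen]), ?_⟩
      rw [List.reverse_eq_iff]
      apply List.ext_getElem <;> simp [hlen]
    have : f ∘ x = y := by
      apply List.ofFn_injective
      apply List.reverse_injective
      rw [hym, ← hx, List.map_reverse, List.map_ofFn]
    rw [← this]
    exact h R.2 x ((relMap_iff t R.2 x).2 ⟨v, hR, hx ▸ hm⟩)
  · intro h r R x hx
    obtain ⟨v, hR, hv⟩ := (relMap_iff t R x).1 hx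
    refine h v ⟨r, R⟩ hR (f ∘ x) ?_
    have := hv.map f
    rwa [List.map_reverse, List.map_ofFn, ← List.append_nil ((path t v).map f)] at this

/-- The number of colour-respecting maps of a tree to `A` with root mapped to `a`. -/
noncomputable def count (t : ColTree E) (a : A) (l : List A) : ℕ :=
  Nat.card {f : Point.{uF, uR, u} t → A // f (root t) = a ∧ RespectsColors t l f}

theorem card_pointedHom [σ.IsRelational] (t : ColTree E) (a : A) :
    Nat.card (PointedHom σ (Point.{uF, uR, u} t) (root t) A a) = count t a [] :=
  Nat.card_congr
    { toFun := fun f => ⟨f.1, f.2, isHom_iff_respectsColors.1 f.1.map_rel'⟩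
      invFun := fun f => ⟨⟨f.1, fun c => isEmptyElim c, isHom_iff_respectsColors.2 f.2.2⟩, f.2.1⟩
      left_inv := fun _ => rfl
      right_inv := fun _ => rfl }

open Classical in
theorem count_leaf (c : Set (Σ n : ℕ, σ.Relations n)) (a : A) (l : List A) :
    count (leaf c : ColTree E) a l =
      if ∀ R ∈ insert (⟨2, E⟩ : Σ n : ℕ, σ.Relations n) c, HoldsAt R (a :: l) then 1 else 0 := by
  have key : ∀ f : Point.{uF, uR, u} (leaf c : ColTree E) → A, f (root (leaf c)) = a →
      (RespectsColors (leaf c) l f ↔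
        ∀ R ∈ insert (⟨2, E⟩ : Σ n : ℕ, σ.Relations n) c, HoldsAt R (a :: l)) := by
    rintro f rfl
    exact ⟨fun h => h (root (leaf c)), fun h v => h⟩
  split_ifs with h
  · refine Nat.card_eq_one_iff_exists.2 ⟨⟨fun _ => a, rfl, (key _ rfl).2 h⟩, fun f => ?_⟩
    exact Subtype.ext (funext fun v => f.2.1)
  · have : IsEmpty {f : Point.{uF, uR, u} (leaf c : ColTree E) → A //
        f (root (leaf c)) = a ∧ RespectsColors (leaf c) l f} :=
      ⟨fun f => h ((key f.1 f.2.1).1 f.2.2)⟩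
    exact Nat.card_of_isEmpty

/-- Once the image of the root is fixed, the maps on the two parts are independent. The sum may run
over all of `A`: `E` is imposed at the root of `t'`, so points that are not successors of `a`
contribute zero. -/
theorem count_graft [Fintype A] (t t' : ColTree E) (a : A) (l : List A) :
    count (graft t t') a l = count t a l * ∑ x : A, count t' x (a :: l) := by
  unfold count
  rw [← Nat.card_sigma, ← Nat.card_prod]
  exact Nat.card_congr
    { toFun := fun f => ⟨⟨f.1 ∘ base, f.2.1, (respectsColors_graft.1 f.2.2).1⟩,
        ⟨f.1 (branch (root t')), f.1 ∘ branch, rfl, by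
          have := (respectsColors_graft.1 f.2.2).2
          rwa [show f.1 (base (root t)) = a from f.2.1] at this⟩⟩
      invFun := fun p => ⟨Sum.elim p.1.1 p.2.2.1, p.1.2.1, respectsColors_graft.2 ⟨p.1.2.2, by
          have h : (Sum.elim p.1.1 p.2.2.1 : Point (graft t t') → A) (base (root t)) = a := p.1.2.1
          rw [h]
          exact p.2.2.2.2⟩⟩
      left_inv := fun f => Subtype.ext (Sum.elim_comp_inl_inr f.1)
      right_inv := by
        rintro ⟨⟨f, hf⟩, ⟨x, g, rfl, hg⟩⟩
        rfl }

theorem count_eq_zero (t : ColTree E) {a : A} {l : List A}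
    (h : ¬ HoldsAt (⟨2, E⟩ : Σ n : ℕ, σ.Relations n) (a :: l)) : count t a l = 0 := by
  have : IsEmpty {f : Point.{uF, uR, u} t → A // f (root t) = a ∧ RespectsColors t l f} := by
    refine ⟨fun f => h ?_⟩
    have := f.2.2 (root t) _ (Set.mem_insert _ _)
    rwa [path_root, List.map_singleton, f.2.1] at this
  exact Nat.card_of_isEmpty

/-- Add colours to the root. -/
def addColor (c : Set (Σ n : ℕ, σ.Relations n)) : ColTree E → ColTree E
  | leaf d => leaf (c ∪ d)
  | graft t t' => graft (addColor c t) t'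

/-- Identify the roots of two trees. -/
def merge (t : ColTree E) : ColTree E → ColTree E
  | leaf c => addColor c t
  | graft s s' => graft (merge t s) s'

theorem height_addColor (c : Set (Σ n : ℕ, σ.Relations n)) (t : ColTree E) :
    (addColor c t).height = t.height := by
  induction t with
  | leaf d => rfl
  | graft t t' ih _ => rw [addColor, height, height, ih]

theorem height_merge (t s : ColTree E) : (merge t s).height = max t.height s.height := by
  induction s with
  | leaf c => rw [merge, height_addColor, height, Nat.max_zero]
  | graft s s' ih _ => rw [merge, height, height, ih, max_assoc]

theorem count_addColor [Finite A] (c : Set (Σ n : ℕ, σ.Relations n)) (t : ColTree E) (a : A)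
    (l : List A) : count (addColor c t) a l = count t a l * count (leaf c : ColTree E) a l := by
  classical
  cases nonempty_fintype A
  induction t with
  | leaf d =>
    rw [addColor, count_leaf, count_leaf, count_leaf, ite_zero_mul_ite_zero, one_mul]
    congr 1
    simp only [Set.mem_insert_iff, Set.mem_union, or_imp, forall_and, forall_eq, eq_iff_iff]
    tauto
  | graft t t' ih _ => rw [addColor, count_graft, count_graft, ih, mul_right_comm]

/-- Trees sharing only a root with prescribed image are mapped independently. This makes the counts
closed under products. -/
theorem count_merge [Finite A] (t s : ColTree E) (a : A) (l : List A) :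
    count (merge t s) a l = count t a l * count s a l := by
  cases nonempty_fintype A
  induction s with
  | leaf c => rw [merge, count_addColor]
  | graft s s' ih _ => rw [merge, count_graft, count_graft, ih, mul_assoc]

end count

end ColTree

end PPML

/-! ### Interpolation on a finite set. -/

/-- A multiplicatively closed set of functions on a finite set spans every function that does not
distinguish more points than the set does. -/
theorem mem_adjoin_of_forall_eq {X : Type*} [Finite X] (M : Set (X → ℚ)) (g : X → ℚ)
    (hg : ∀ p q, (∀ h ∈ M, h p = h q) → g p = g q) : g ∈ Algebra.adjoin ℚ M := by
  classical
  cases nonempty_fintype X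
  set S := Algebra.adjoin ℚ M
  let s : Setoid X := ⟨fun p q => ∀ h ∈ M, h p = h q, fun _ _ _ => rfl,
    fun H h hh => (H h hh).symm, fun H₁ H₂ h hh => (H₁ h hh).trans (H₂ h hh)⟩
  have indicator : ∀ p : X, ∃ δ ∈ S, ∀ q, δ q = if s p q then 1 else 0 := by
    intro p
    have factor : ∀ q : X, ∃ δ ∈ S, (∀ p', s p p' → δ p' = 1) ∧ (¬ s p q → δ q = 0) := by
      intro q
      by_cases hpq : s p q
      · exact ⟨1, S.one_mem, fun _ _ => rfl, fun h => absurd hpq h⟩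
      · obtain ⟨h, hM, hne⟩ : ∃ h ∈ M, h p ≠ h q := by
          by_contra! H
          exact hpq H
        -- A Lagrange factor: `h` is constant on the class of `p`, so the value is one there, and it
        -- is zero at `q`.
        refine ⟨(h p - h q)⁻¹ • (h - algebraMap ℚ (X → ℚ) (h q)),
          S.smul_mem (S.sub_mem (Algebra.subset_adjoin hM) (S.algebraMap_mem _)) _, ?_, ?_⟩
        · intro p' hp'
          have : h p' = h p := (hp' h hM).symm
          simp [this, inv_mul_cancel₀ (sub_ne_zero.2 hne)]
        · intro _
          simp
    choose δ hS h₁ h₀ using factor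
    refine ⟨∏ q, δ q, S.prod_mem fun q _ => hS q, fun q => ?_⟩
    rw [Finset.prod_apply]
    split_ifs with hpq
    · exact Finset.prod_eq_one fun i _ => h₁ i q hpq
    · exact Finset.prod_eq_zero (Finset.mem_univ q) (h₀ q hpq)
  choose δ hS hδ using indicator
  have : g = ∑ c : Quotient s, g c.out • δ c.out := by
    funext x
    rw [Finset.sum_apply, Finset.sum_eq_single (⟦x⟧ : Quotient s)]
    · have hx : s (Quotient.out (⟦x⟧ : Quotient s)) x := Quotient.mk_out x
      simp [hδ, hx, hg _ _ hx]
    · intro c _ hc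
      have : ¬ s c.out x := fun h => hc (by rw [← Quotient.out_eq c]; exact Quotient.sound h)
      simp [hδ, this]
    · simp
  rw [this]
  exact S.sum_mem fun c _ => S.smul_mem (hS _) _

/-- The algebra generated by a submonoid is its linear span, so functionals agreeing on `M` agree on
whatever is interpolated from it. -/
theorem eq_of_forall_mem_submonoid {X : Type*} [Finite X] (M : Submonoid (X → ℚ))
    (L₁ L₂ : (X → ℚ) →ₗ[ℚ] ℚ) (hL : ∀ h ∈ M, L₁ h = L₂ h) (g : X → ℚ)
    (hg : ∀ p q, (∀ h ∈ M, h p = h q) → g p = g q) : L₁ g = L₂ g := by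
  have h : g ∈ Subalgebra.toSubmodule (Algebra.adjoin ℚ (M : Set (X → ℚ))) :=
    mem_adjoin_of_forall_eq _ g hg
  rw [Algebra.adjoin_eq_span, Submonoid.closure_eq] at h
  exact LinearMap.eqOn_span (fun h hh => hL h hh) h

/-! ### From equal counts to equal truth values. -/

namespace PPML

open FirstOrder.Language.Structure ColTree

variable {σ : FirstOrder.Language.{uF, uR}} {E : σ.Relations 2}

theorem holdsAt_accessibility_iff {A : Type u} [σ.Structure A] (x a : A) (l : List A) :
    HoldsAt (⟨2, E⟩ : Σ n : ℕ, σ.Relations n) (x :: a :: l) ↔ accRel E A a x := by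
  constructor
  · intro h
    exact h ![a, x] ⟨l, by simp⟩
  · rintro h y ⟨m, hm⟩
    have hy : y = ![a, x] := by
      simp [List.ofFn_succ] at hm
      ext i
      fin_cases i
      · exact hm.2.1
      · exact hm.1
    rw [hy]
    exact h

/-- On a history shorter than the arity `HoldsAt` is vacuous whereas the atom is false; hence the
length condition. -/
theorem satAt_atom_iff {A : Type u} [σ.Structure A] {r : ℕ} (R : σ.Relations r)
    (hR : (⟨r, R⟩ : Σ n : ℕ, σ.Relations n) ≠ ⟨2, E⟩) (a : A) (l : List A) :
    SatAt A (.atom R hR) a l ↔ r ≤ (a :: l).length ∧ HoldsAt ⟨r, R⟩ (a :: l) := by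
  constructor
  · rintro ⟨x, hx, hRx⟩
    refine ⟨by simpa using hx.length_le, fun y hy => ?_⟩
    have := List.prefix_of_prefix_length_le hy hx (by simp)
    have := List.reverse_injective (this.eq_of_length (by simp))
    rwa [List.ofFn_injective this]
  · rintro ⟨hr, h⟩
    obtain ⟨x, hx⟩ : ∃ x : Fin r → A, (List.ofFn x).reverse <+: a :: l := by
      have hlen : ((a :: l).take r).reverse.length = r := by
        rw [List.length_reverse, List.length_take, min_eq_left hr]
      refine ⟨fun i => ((a :: l).take r).reverse[i]'(by rw [hlen]; exact i.2), ?_⟩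
      have : (List.ofFn fun i : Fin r =>
          ((a :: l).take r).reverse[i]'(by rw [hlen]; exact i.2)) = ((a :: l).take r).reverse :=
        List.ext_getElem (by rw [List.length_ofFn]; exact hlen.symm) (by simp)
      rw [this, List.reverse_reverse]
      exact List.take_prefix _ _
    exact ⟨x, hx, h x hx⟩

theorem encard_setOf_and_eq {A : Type u} [Finite A] (P Q : A → Prop) [Fintype {x // P x}]
    [DecidablePred Q] : Set.encard {x | P x ∧ Q x} =
      ((Finset.univ.filter fun x : {x // P x} => Q x.1).card : ℕ∞) := by
  rw [← Set.encard_coe_eq_coe_finsetCard, ← Subtype.val_injective.injOn.encard_image]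
  congr 1
  ext x
  simp [and_comm]

theorem sum_successors_count {A : Type u} [Fintype A] [σ.Structure A] (t : ColTree E) (a : A)
    (l : List A) [Fintype {x // accRel E A a x}] :
    ∑ x : {x // accRel E A a x}, count t x.1 (a :: l) = ∑ x : A, count t x (a :: l) := by
  classical
  rw [← Finset.sum_subtype (Finset.univ.filter fun x => accRel E A a x) (by simp)
    (fun x => count t x (a :: l))]
  refine Finset.sum_filter_of_ne fun x _ hx => ?_
  by_contra h
  exact hx (count_eq_zero t fun h' => h ((holdsAt_accessibility_iff x a l).1 h'))

/-- Class functions of the successors of two histories have equal sums, if their counts of coloured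
trees agree. -/
theorem sum_successors_eq {A B : Type u} [Finite A] [Finite B] [σ.Structure A] [σ.Structure B]
    {j : ℕ} {a : A} {l : List A} {b : B} {m : List B}
    [Fintype {x // accRel E A a x}] [Fintype {y // accRel E B b y}]
    (ha : HoldsAt (⟨2, E⟩ : Σ n : ℕ, σ.Relations n) (a :: l))
    (hb : HoldsAt (⟨2, E⟩ : Σ n : ℕ, σ.Relations n) (b :: m))
    (h : ∀ t : ColTree E, t.height ≤ j + 1 → count t a l = count t b m)
    (g : {x // accRel E A a x} ⊕ {y // accRel E B b y} → ℚ)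
    (hg : ∀ p q, (∀ t : ColTree E, t.height ≤ j →
      Sum.elim (fun x : {x // accRel E A a x} => count t x.1 (a :: l))
        (fun y : {y // accRel E B b y} => count t y.1 (b :: m)) p =
      Sum.elim (fun x : {x // accRel E A a x} => count t x.1 (a :: l))
        (fun y : {y // accRel E B b y} => count t y.1 (b :: m)) q) → g p = g q) :
    ∑ x, g (Sum.inl x) = ∑ y, g (Sum.inr y) := by
  classical
  cases nonempty_fintype A
  cases nonempty_fintype B
  let H : ColTree E → {x // accRel E A a x} ⊕ {y // accRel E B b y} → ℕ := fun t =>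
    Sum.elim (fun x => count t x.1 (a :: l)) (fun y => count t y.1 (b :: m))
  -- The unit is the count of `leaf ∅`, which is one since only the edge condition remains and it
  -- holds at successors; products come from `merge`.
  let M : Submonoid ({x // accRel E A a x} ⊕ {y // accRel E B b y} → ℚ) :=
    { carrier := {f | ∃ t : ColTree E, t.height ≤ j ∧ f = fun p => (H t p : ℚ)}
      one_mem' := by
        refine ⟨leaf ∅, Nat.zero_le _, ?_⟩
        funext p
        rcases p with x | y
        · have := x.2
          simp [H, count_leaf, holdsAt_accessibility_iff, this]
        · have := y.2
          simp [H, count_leaf, holdsAt_accessibility_iff, this]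
      mul_mem' := by
        rintro _ _ ⟨t, ht, rfl⟩ ⟨s, hs, rfl⟩
        refine ⟨merge t s, by rw [height_merge]; exact max_le ht hs, ?_⟩
        funext p
        rcases p with x | y <;> simp [H, count_merge] }
  let L₁ : ({x // accRel E A a x} ⊕ {y // accRel E B b y} → ℚ) →ₗ[ℚ] ℚ :=
    ∑ x, LinearMap.proj (Sum.inl x)
  let L₂ : ({x // accRel E A a x} ⊕ {y // accRel E B b y} → ℚ) →ₗ[ℚ] ℚ :=
    ∑ y, LinearMap.proj (Sum.inr y)
  have key := eq_of_forall_mem_submonoid M L₁ L₂ (by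
    rintro _ ⟨t, ht, rfl⟩
    -- Below a bare root, which contributes a factor one by `ha` and `hb`, the count of `t` is
    -- summed over the successors, at the cost of one level.
    have hle : (graft (leaf ∅) t).height ≤ j + 1 := by
      simp only [height]
      omega
    have := h _ hle
    rw [count_graft, count_graft, count_leaf, count_leaf, if_pos (by simpa using ha),
      if_pos (by simpa using hb), one_mul, one_mul, ← sum_successors_count,
      ← sum_successors_count] at this
    simp only [L₁, L₂, LinearMap.sum_apply, LinearMap.proj_apply, H, Sum.elim_inl, Sum.elim_inr]
    exact_mod_cast this) g (by
    intro p q hpq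
    refine hg p q fun t ht => ?_
    exact_mod_cast hpq _ ⟨t, ht, rfl⟩)
  simpa [L₁, L₂, LinearMap.sum_apply] using key

/-- The structures are quantified inside the induction because the modal case also compares two
successors within the same structure. Equal lengths serve the atoms, which colours cannot test on
short histories. -/
theorem satAt_iff_of_count_eq (φ : Formula σ E) : ∀ {A B : Type u} [Finite A] [Finite B]
    [σ.Structure A] [σ.Structure B] {j : ℕ} {a : A} {l : List A} {b : B} {m : List B},
    φ.depth ≤ j → l.length = m.length →
    HoldsAt (⟨2, E⟩ : Σ n : ℕ, σ.Relations n) (a :: l) →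
    HoldsAt (⟨2, E⟩ : Σ n : ℕ, σ.Relations n) (b :: m) →
    (∀ t : ColTree E, t.height ≤ j → count t a l = count t b m) →
    (SatAt A φ a l ↔ SatAt B φ b m) := by
  classical
  induction φ with
  | top => intros; simp [SatAt]
  | @atom r R hR =>
    intro A B _ _ _ _ j a l b m _ hlen ha hb h
    rw [satAt_atom_iff, satAt_atom_iff, List.length_cons, List.length_cons, hlen]
    refine and_congr_right fun _ => ?_
    have := h (leaf {⟨r, R⟩}) (Nat.zero_le _)
    rw [count_leaf, count_leaf] at this
    simp only [Set.mem_insert_iff, Set.mem_singleton_iff, forall_eq_or_imp, forall_eq, ha, hb,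
      true_and] at this
    by_cases h₁ : HoldsAt ⟨r, R⟩ (a :: l) <;> by_cases h₂ : HoldsAt ⟨r, R⟩ (b :: m) <;>
      simp_all
  | neg φ ih =>
    intro A B _ _ _ _ j a l b m hφ hlen ha hb h
    rw [SatAt, SatAt, ih hφ hlen ha hb h]
  | and φ ψ ih₁ ih₂ =>
    intro A B _ _ _ _ j a l b m hφ hlen ha hb h
    rw [SatAt, SatAt, ih₁ ((le_max_left _ _).trans hφ) hlen ha hb h,
      ih₂ ((le_max_right _ _).trans hφ) hlen ha hb h]
  | dia n φ ih =>
    intro A B _ _ _ _ j a l b m hφ hlen ha hb h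
    cases nonempty_fintype A
    cases nonempty_fintype B
    obtain ⟨j, rfl⟩ : ∃ i, j = i + 1 := ⟨j - 1, by simp only [Formula.depth] at hφ; omega⟩
    have hφ' : φ.depth ≤ j := by simpa [Formula.depth] using hφ
    -- The function summed is the indicator of truth of `φ`, so the sums are the numbers of
    -- successors satisfying it; the induction hypothesis makes it constant on classes.
    have key := sum_successors_eq ha hb h (Sum.elim
      (fun x => if SatAt A φ x.1 (a :: l) then 1 else 0)
      (fun y => if SatAt B φ y.1 (b :: m) then 1 else 0)) (by
      have len : (a :: l).length = (b :: m).length := by simp [hlen]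
      rintro (x | y) (x' | y') hpq
      · have := ih (j := j) hφ' rfl ((holdsAt_accessibility_iff _ _ _).2 x.2)
          ((holdsAt_accessibility_iff _ _ _).2 x'.2) hpq
        simp only [Sum.elim_inl, this]
      · have := ih (j := j) hφ' len ((holdsAt_accessibility_iff _ _ _).2 x.2)
          ((holdsAt_accessibility_iff _ _ _).2 y'.2) hpq
        simp only [Sum.elim_inl, Sum.elim_inr, this]
      · have := ih (j := j) hφ' len.symm ((holdsAt_accessibility_iff _ _ _).2 y.2)
          ((holdsAt_accessibility_iff _ _ _).2 x'.2) hpq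
        simp only [Sum.elim_inl, Sum.elim_inr, this]
      · have := ih (j := j) hφ' rfl ((holdsAt_accessibility_iff _ _ _).2 y.2)
          ((holdsAt_accessibility_iff _ _ _).2 y'.2) hpq
        simp only [Sum.elim_inr, this])
    simp only [Sum.elim_inl, Sum.elim_inr, Finset.sum_boole] at key
    rw [SatAt, SatAt, encard_setOf_and_eq, encard_setOf_and_eq, Nat.cast_injective key]

end PPML

theorem mainTheorem5 {σ : FirstOrder.Language.{uF, uR}} [σ.IsRelational]
    [IsEmpty (σ.Relations 0)] (E : σ.Relations 2) (k : ℕ)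
    (A B : Type u) [Finite A] [Finite B] [σ.Structure A] [σ.Structure B] (a : A) (b : B) :
    PPML.GradedEquiv E k A a B b ↔
      ∀ (T : Type u) [Finite T] [σ.Structure T] (t : T),
        PPML.IsPPTree E T t → PPML.HeightLE (PPML.accRel E T) t k →
          Nat.card (PPML.PointedHom σ T t A a) = Nat.card (PPML.PointedHom σ T t B b) := by
  rw [PPML.gradedEquiv_iff_equivAt]
  refine ⟨fun h T _ _ t hT hk => PPML.card_pointedHom_eq h hT hk, fun h φ hφ => ?_⟩
  -- A history with one entry has no last pair, so the condition on `E` is vacuous.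
  have holds : ∀ {C : Type u} [σ.Structure C] (c : C),
      PPML.ColTree.HoldsAt (⟨2, E⟩ : Σ n : ℕ, σ.Relations n) [c] := by
    intro C _ c x hx
    simpa using hx.length_le
  refine PPML.satAt_iff_of_count_eq φ hφ rfl (holds a) (holds b) fun t ht => ?_
  rw [← PPML.ColTree.card_pointedHom, ← PPML.ColTree.card_pointedHom]
  exact h _ _ t.isPPTree (t.heightLE ht)
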